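/- Let $X$ be a real Banach space, let $K \subset X$ be compact, and let $n \ge 0$ be an integer. Let $S^n = \{x \in \mathbb{R}^{n+1} : \|x\| = 1\}$ be the Euclidean unit sphere. Define the sphere embedding width of $K$ by $$ s_n(K)_X := \sup_{c} \inf_{z \in S^n} \|c(z)\|_X, $$ where the supremum is over all continuous odd maps $c : S^n \to K$ (that is, $c(-z) = -c(z)$ for all $z \in S^n$), and is $0$ if there are no such maps. Define the manifold width of $K$ by $$ \delta_n(K)_X := \inf_{a, M} \sup_{f \in K} \|f - M(a(f))\|_X, $$ where the infimum is over all pairs of continuous maps $a : K \to \mathbb{R}^n$ and $M : \mathbb{R}^n \to X$, and the supremum over $K$ is $0$ if $K$ is empty. Then $$ s_n(K)_X \le \delta_n(K)_X . $$ -/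

import Mathlib

open scoped ENNReal

/-- The unit sphere `S^n = {x ∈ ℝ^{n+1} : ‖x‖ = 1}` (Euclidean norm). -/
abbrev UnitSphere (n : ℕ) : Type :=
  Metric.sphere (0 : EuclideanSpace ℝ (Fin (n + 1))) 1

/-- The manifold `n`-width of `K ⊆ X`: the infimum over continuous encoders `a : K → ℝⁿ` and
continuous decoders `M : ℝⁿ → X` of `sup_{f ∈ K} ‖f - M (a f)‖`, as an extended nonnegative
real, so that suprema and infima have no default values (the norm is read in `ℝ≥0∞`). -/
noncomputable def manifoldWidth {X : Type*} [NormedAddCommGroup X] [NormedSpace ℝ X]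
    (n : ℕ) (K : Set X) : ℝ≥0∞ :=
  ⨅ (a : C(K, EuclideanSpace ℝ (Fin n))) (M : C(EuclideanSpace ℝ (Fin n), X)),
    ⨆ f : K, ‖(f : X) - M (a f)‖ₑ

/-- The sphere embedding `n`-width of `K ⊆ X`: the supremum over continuous odd maps
`c : S^n → K` of `inf_{z ∈ S^n} ‖c z‖`. If there is no such map, the supremum is `0`. -/
noncomputable def sphereEmbeddingWidth {X : Type*} [NormedAddCommGroup X] [NormedSpace ℝ X]
    (n : ℕ) (K : Set X) : ℝ≥0∞ :=
  ⨆ (c : C(UnitSphere n, K)) (_ : ∀ z : UnitSphere n, (c (-z) : X) = -(c z : X)),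
    ⨅ z : UnitSphere n, ‖(c z : X)‖ₑ

/-! ### Real points of real algebras of odd dimension -/

/-! By Borsuk–Ulam (`borsukUlam`), the code `a ∘ c` identifies some antipodal pair, so `c z` and `-c
z` are decoded to the same point, and one of the two errors is at least `‖c z‖`.

Borsuk–Ulam is proved algebraically. On the sphere an odd map is uniformly close to a system of `n`
forms of one odd degree `d` in `n + 1` variables. Setting the first variable to `1` gives
polynomials `gᵢ` of degree at most `d`. For all but countably many `t`, the system `xᵢ ^ d + t gᵢ =
0` defines a real algebra of dimension `d ^ n`, which is odd, so it has a real point. Rescaled to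
the sphere, this point makes every form at most `1 / t` in absolute value. -/

theorem even_finrank_of_isFiniteLength {B : Type*} [CommRing B] [Algebra ℝ B]
    [FiniteDimensional ℝ B]
    (hB : ∀ I : Ideal B, I.IsMaximal → Even (Module.finrank ℝ (B ⧸ I)))
    {M : Type*} [AddCommGroup M] [Module B M] (h : IsFiniteLength B M) :
    ∀ [Module ℝ M] [IsScalarTower ℝ B M], Even (Module.finrank ℝ M) := by
  -- The real structure stays quantified in the goal, because the induction runs over `B`-modules.
  induction h with
  | of_subsingleton =>
    intro _ _
    rw [Module.finrank_zero_of_subsingleton]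
    exact Even.zero
  | @of_simple_quotient M _ _ N hs hN ih =>
    intro _ _
    have : Module.Finite B M := by
      have := isFiniteLength_iff_isNoetherian_isArtinian.1 (IsFiniteLength.of_simple_quotient hN)
      have := this.1
      infer_instance
    have : Module.Finite ℝ M := Module.Finite.trans B M
    have h1 := (N.restrictScalars ℝ).finrank_quotient_add_finrank
    obtain ⟨I, hI, ⟨e⟩⟩ := isSimpleModule_iff_quot_maximal.1 hs
    have h2 : Module.finrank ℝ (M ⧸ N.restrictScalars ℝ) = Module.finrank ℝ (B ⧸ I) :=
      ((Submodule.Quotient.restrictScalarsEquiv ℝ N).trans (e.restrictScalars ℝ)).finrank_eq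
    have h3 : Even (Module.finrank ℝ (N.restrictScalars ℝ)) := ih
    rw [← h1, h2]
    exact (hB I hI).add h3

/-- Every residue field is `ℝ` or `ℂ`. If none were `ℝ`, all composition factors of `B` would have
real dimension 2. -/
theorem exists_algHom_real_of_odd_finrank {B : Type*} [CommRing B] [Algebra ℝ B]
    (hodd : Odd (Module.finrank ℝ B)) : Nonempty (B →ₐ[ℝ] ℝ) := by
  have : FiniteDimensional ℝ B := Module.finite_of_finrank_pos hodd.pos
  have : IsArtinianRing B := IsArtinianRing.of_finite ℝ B
  by_contra hne
  refine Nat.not_even_iff_odd.2 hodd (even_finrank_of_isFiniteLength (B := B) ?_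
    (isFiniteLength_iff_isNoetherian_isArtinian.2 ⟨inferInstance, inferInstance⟩))
  intro I hI
  let : Field (B ⧸ I) := Ideal.Quotient.field I
  rcases Real.nonempty_algEquiv_or (B ⧸ I) with ⟨⟨e⟩⟩ | ⟨⟨e⟩⟩
  · exact absurd ⟨(e : (B ⧸ I) →ₐ[ℝ] ℝ).comp (Ideal.Quotient.mkₐ ℝ I)⟩ hne
  · rw [e.toLinearEquiv.finrank_eq, Complex.finrank_real_complex]
    exact even_two

/-! ### Perturbed monomials -/

section PerturbedMonomials

open MvPolynomial

variable {σ : Type*}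

/-- A family of polynomials whose `m`-th member has degree at most `|m|`, and whose coefficient
matrices in all bounded degrees are invertible, is linearly independent. -/
theorem linearIndependent_of_det_coeff_ne_zero {k : Type*} [Field k]
    [∀ N : ℕ, Fintype {m : σ →₀ ℕ // m.degree ≤ N}] [DecidableEq σ]
    (v : (σ →₀ ℕ) → MvPolynomial σ k)
    (hdet : ∀ N : ℕ, (Matrix.of fun m m' : {m : σ →₀ ℕ // m.degree ≤ N} =>
      coeff m'.1 (v m.1)).det ≠ 0) : LinearIndependent k v := by
  rw [linearIndependent_iff'']
  intro s c hc hs m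
  by_cases hm : m ∈ s
  swap
  · exact hc m hm
  -- A relation supported on `s` is a row vector killed by the level-`N` matrix.
  set N := s.sup Finsupp.degree
  have hle : ∀ m ∈ s, m.degree ≤ N := fun m hm => Finset.le_sup (f := Finsupp.degree) hm
  have hv := Matrix.eq_zero_of_vecMul_eq_zero (hdet N)
    (v := fun m : {m : σ →₀ ℕ // m.degree ≤ N} => c m.1) ?_
  · exact congrFun hv ⟨m, hle m hm⟩
  funext m'
  have h0 := congrArg (coeff m'.1) hs
  simp only [coeff_sum, coeff_smul, coeff_zero, smul_eq_mul] at h0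
  simp only [Matrix.vecMul, dotProduct, Matrix.of_apply, Pi.zero_apply]
  rw [← h0]
  symm
  refine Finset.sum_of_injOn (fun m => if h : m.degree ≤ N then ⟨m, h⟩ else m') ?_ ?_ ?_ ?_
  · intro a ha b hb hab
    simpa [hle a ha, hle b hb] using hab
  · intro a _
    simp
  · intro a _ ha
    have : a.1 ∉ s := by
      intro has
      exact ha ⟨a.1, has, by simp [a.2]⟩
    simp [hc _ this]
  · intro a ha
    simp [hle a ha]

/-- A row of the inverse matrix expresses a monomial through the `v m`; the degree bound excludes
terms above that level. -/
theorem span_eq_top_of_det_coeff_ne_zero {k : Type*} [Field k]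
    [∀ N : ℕ, Fintype {m : σ →₀ ℕ // m.degree ≤ N}] [DecidableEq σ]
    (v : (σ →₀ ℕ) → MvPolynomial σ k) (hv : ∀ m, (v m).totalDegree ≤ m.degree)
    (hdet : ∀ N : ℕ, (Matrix.of fun m m' : {m : σ →₀ ℕ // m.degree ≤ N} =>
      coeff m'.1 (v m.1)).det ≠ 0) : ⊤ ≤ Submodule.span k (Set.range v) := by
  have key : ∀ m : σ →₀ ℕ, monomial m 1 ∈ Submodule.span k (Set.range v) := by
    intro m₀
    set A := (Matrix.of fun m m' : {m : σ →₀ ℕ // m.degree ≤ m₀.degree} => coeff m'.1 (v m.1))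
      with hA
    have hBA : A⁻¹ * A = 1 := Matrix.nonsing_inv_mul A (isUnit_iff_ne_zero.2 (hdet _))
    have : monomial m₀ 1 = ∑ m, A⁻¹ ⟨m₀, le_rfl⟩ m • v m.1 := by
      ext m'
      simp only [coeff_sum, coeff_smul, smul_eq_mul]
      by_cases hm' : m'.degree ≤ m₀.degree
      · have := congrFun (congrFun hBA ⟨m₀, le_rfl⟩) ⟨m', hm'⟩
        rw [Matrix.mul_apply] at this
        simp only [hA, Matrix.of_apply] at this
        rw [this, coeff_monomial, Matrix.one_apply]
        simp
      · rw [coeff_monomial, if_neg (by rintro rfl; exact hm' le_rfl), Finset.sum_eq_zero]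
        intro m _
        rw [coeff_eq_zero_of_totalDegree_lt, mul_zero]
        refine lt_of_le_of_lt (hv m.1) ?_
        have := m.2
        change _ < m'.degree
        omega
    rw [this]
    exact Submodule.sum_mem _ fun m _ =>
      Submodule.smul_mem _ _ (Submodule.subset_span ⟨m.1, rfl⟩)
  intro p _
  rw [p.as_sum]
  refine Submodule.sum_mem _ fun m _ => ?_
  have : monomial m (coeff m p) = coeff m p • monomial m (1 : k) := by
    rw [smul_monomial, smul_eq_mul, mul_one]
  rw [this]
  exact Submodule.smul_mem _ _ (key m)

variable [Fintype σ]

/-- The monomial `∏ xᵢ ^ mᵢ` in which each full power `xᵢ ^ d` is replaced by `xᵢ ^ d + gᵢ`. -/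
noncomputable def perturbedMonomial {R : Type*} [CommSemiring R] (d : ℕ)
    (g : σ → MvPolynomial σ R) (m : σ →₀ ℕ) : MvPolynomial σ R :=
  ∏ i, (X i ^ (m i % d) * (X i ^ d + g i) ^ (m i / d))

theorem totalDegree_perturbedMonomial_le {R : Type*} [CommSemiring R] [Nontrivial R] (d : ℕ)
    (g : σ → MvPolynomial σ R) (hg : ∀ i, (g i).totalDegree ≤ d) (m : σ →₀ ℕ) :
    (perturbedMonomial d g m).totalDegree ≤ m.degree := by
  rw [Finsupp.degree_eq_sum]
  refine (totalDegree_finsetProd _ _).trans (Finset.sum_le_sum fun i _ => ?_)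
  refine (totalDegree_mul _ _).trans ?_
  rw [totalDegree_X_pow]
  have h1 : (X i ^ d + g i : MvPolynomial σ R).totalDegree ≤ d :=
    (totalDegree_add _ _).trans (max_le (totalDegree_X_pow i d).le (hg i))
  calc m i % d + ((X i ^ d + g i : MvPolynomial σ R) ^ (m i / d)).totalDegree
      ≤ m i % d + (m i / d) * d :=
        Nat.add_le_add_left ((totalDegree_pow _ _).trans (Nat.mul_le_mul_left _ h1)) _
    _ = m i := Nat.mod_add_div' _ _

theorem map_perturbedMonomial {R S : Type*} [CommSemiring R] [CommSemiring S] (f : R →+* S)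
    (d : ℕ) (g : σ → MvPolynomial σ R) (m : σ →₀ ℕ) :
    map f (perturbedMonomial d g m) = perturbedMonomial d (fun i => map f (g i)) m := by
  simp [perturbedMonomial, map_prod]

theorem perturbedMonomial_zero {R : Type*} [CommSemiring R] (d : ℕ) (m : σ →₀ ℕ) :
    perturbedMonomial d (0 : σ → MvPolynomial σ R) m = monomial m 1 := by
  rw [monomial_eq, C_1, one_mul, Finsupp.prod_fintype _ _ (fun i => pow_zero _)]
  refine Finset.prod_congr rfl fun i _ => ?_
  rw [Pi.zero_apply, add_zero, ← pow_mul, ← pow_add, Nat.mod_add_div]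

/-- Multiplication by a generator of the ideal thus only shifts an exponent by `d`. -/
theorem perturbedMonomial_add_single [DecidableEq σ] {R : Type*} [CommSemiring R] {d : ℕ}
    (hd : 0 < d) (g : σ → MvPolynomial σ R) (m : σ →₀ ℕ) (i : σ) :
    perturbedMonomial d g (m + Finsupp.single i d) =
      (X i ^ d + g i) * perturbedMonomial d g m := by
  unfold perturbedMonomial
  rw [← Finset.mul_prod_erase _ _ (Finset.mem_univ i),
    ← Finset.mul_prod_erase (a := i) Finset.univ _ (Finset.mem_univ i)]
  have : ∀ j ∈ Finset.univ.erase i, X j ^ ((m + Finsupp.single i d) j % d) *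
      (X j ^ d + g j) ^ ((m + Finsupp.single i d) j / d) =
      X j ^ (m j % d) * (X j ^ d + g j) ^ (m j / d) := by
    intro j hj
    have hji : i ≠ j := (Finset.ne_of_mem_erase hj).symm
    simp [hji]
  rw [Finset.prod_congr rfl this]
  simp only [Finsupp.add_apply, Finsupp.single_eq_same, Nat.add_mod_right,
    Nat.add_div_right _ hd, pow_succ]
  ring

/-- For all but countably many `t`, the perturbed monomials with perturbation `t • g` form a
basis of the polynomial ring. -/
theorem exists_countable_perturbedMonomial_basis {k : Type*} [Field k] (d : ℕ)
    (g : σ → MvPolynomial σ k) (hg : ∀ i, (g i).totalDegree ≤ d) :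
    ∃ E : Set k, E.Countable ∧ ∀ t ∉ E,
      LinearIndependent k (perturbedMonomial d (fun i => C t * g i)) ∧
      ⊤ ≤ Submodule.span k (Set.range (perturbedMonomial d (fun i => C t * g i))) := by
  classical
  let (N : ℕ) : Fintype {m : σ →₀ ℕ // m.degree ≤ N} := (Finsupp.finite_of_degree_le N).fintype
  -- With `t` an indeterminate, each determinant is a polynomial in `t` with value 1 at `t = 0`,
  -- hence has finitely many roots.
  let G : σ → MvPolynomial σ (Polynomial k) := fun i => C Polynomial.X * map Polynomial.C (g i)
  let A : ∀ N : ℕ, Matrix {m : σ →₀ ℕ // m.degree ≤ N} {m : σ →₀ ℕ // m.degree ≤ N}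
      (Polynomial k) := fun N => Matrix.of fun m m' => coeff m'.1 (perturbedMonomial d G m.1)
  have hmap : ∀ (t : k) (m : σ →₀ ℕ), map (Polynomial.evalRingHom t) (perturbedMonomial d G m) =
      perturbedMonomial d (fun i => C t * g i) m := by
    intro t m
    rw [map_perturbedMonomial]
    congr 1
    funext i
    have : (Polynomial.evalRingHom t).comp Polynomial.C = RingHom.id k := by ext; simp
    simp only [G, map_mul, map_C, map_map, this, map_id, Polynomial.coe_evalRingHom,
      Polynomial.eval_X]
  have hdet : ∀ (t : k) (N : ℕ), (A N).det.eval t =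
      (Matrix.of fun m m' : {m : σ →₀ ℕ // m.degree ≤ N} =>
        coeff m'.1 (perturbedMonomial d (fun i => C t * g i) m.1)).det := by
    intro t N
    rw [← Polynomial.coe_evalRingHom, RingHom.map_det]
    congr 1
    ext m m'
    simp only [RingHom.mapMatrix_apply, Matrix.map_apply, Matrix.of_apply, A]
    rw [← coeff_map, hmap]
  have hne : ∀ N, (A N).det ≠ 0 := by
    intro N h0
    have h1 := hdet 0 N
    have h2 : (fun i => C 0 * g i) = (0 : σ → MvPolynomial σ k) := by funext i; simp
    rw [h0, h2] at h1
    have h3 : (Matrix.of fun m m' : {m : σ →₀ ℕ // m.degree ≤ N} =>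
        coeff m'.1 (perturbedMonomial d (0 : σ → MvPolynomial σ k) m.1)) = 1 := by
      ext m m'
      simp [perturbedMonomial_zero, coeff_monomial, Matrix.one_apply, Subtype.ext_iff]
    rw [h3] at h1
    simp at h1
  refine ⟨⋃ N, {t | (A N).det.IsRoot t}, Set.countable_iUnion fun N =>
    (Polynomial.finite_setOfPred_isRoot (hne N)).countable, fun t ht => ?_⟩
  have ht' : ∀ N, (Matrix.of fun m m' : {m : σ →₀ ℕ // m.degree ≤ N} =>
      coeff m'.1 (perturbedMonomial d (fun i => C t * g i) m.1)).det ≠ 0 := by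
    intro N h0
    refine ht (Set.mem_iUnion.2 ⟨N, ?_⟩)
    change (A N).det.eval t = 0
    rw [hdet, h0]
  have hdeg : ∀ i, (C t * g i).totalDegree ≤ d := fun i =>
    (totalDegree_mul _ _).trans (by simpa using hg i)
  exact ⟨linearIndependent_of_det_coeff_ne_zero _ ht',
    span_eq_top_of_det_coeff_ne_zero _ (totalDegree_perturbedMonomial_le d _ hdeg) ht'⟩

/-- If the perturbed monomials form a basis, then the perturbed powers `xᵢ ^ d + gᵢ` cut out an
algebra of dimension `d ^ |σ|`. -/
theorem finrank_quotient_span_perturbed {k : Type*} [Field k] {d : ℕ} (hd : 0 < d)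
    (g : σ → MvPolynomial σ k) (hli : LinearIndependent k (perturbedMonomial d g))
    (hsp : ⊤ ≤ Submodule.span k (Set.range (perturbedMonomial d g))) :
    Module.finrank k (MvPolynomial σ k ⧸ Ideal.span (Set.range fun i => X i ^ d + g i)) =
      d ^ Fintype.card σ := by
  classical
  set I := Ideal.span (Set.range fun i => X i ^ d + g i) with hI
  let b := Module.Basis.mk hli hsp
  have hb : ∀ m, b m = perturbedMonomial d g m := fun m => Module.Basis.mk_apply hli hsp m
  let S : Set (σ →₀ ℕ) := {m | ∀ i, m i < d}
  -- The ideal is spanned by the basis vectors with some exponent at least `d`, which are those that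
  -- `L` discards.
  let L : MvPolynomial σ k →ₗ[k] (S →₀ k) := Finsupp.lsubtypeDomain S ∘ₗ b.repr.toLinearMap
  have hL : ∀ p (m : S), L p m = b.repr p m := fun p m => rfl
  have hLsurj : Function.Surjective L := by
    intro f
    refine ⟨b.repr.symm (f.mapDomain Subtype.val), ?_⟩
    ext m
    rw [hL, LinearEquiv.apply_symm_apply, Finsupp.mapDomain_apply Subtype.val_injective]
  have hker : LinearMap.ker L = I.restrictScalars k := by
    apply le_antisymm
    · intro p hp
      rw [Submodule.restrictScalars_mem, ← b.linearCombination_repr p,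
        Finsupp.linearCombination_apply]
      refine Submodule.sum_mem _ fun m _ => ?_
      by_cases hm : m ∈ S
      · have : b.repr p m = 0 := by
          rw [← hL p ⟨m, hm⟩, LinearMap.mem_ker.1 hp]
          rfl
        simp [this]
      · simp only [S, Set.mem_ofPred_eq, not_forall, not_lt] at hm
        obtain ⟨i, hi⟩ := hm
        have hle : Finsupp.single i d ≤ m := by simpa using hi
        have : m = (m - Finsupp.single i d) + Finsupp.single i d := (tsub_add_cancel_of_le hle).symm
        change b.repr p m • b m ∈ I
        rw [smul_eq_C_mul, hb]
        refine I.mul_mem_left _ ?_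
        rw [this, perturbedMonomial_add_single hd]
        exact I.mul_mem_right _ (Ideal.subset_span ⟨i, rfl⟩)
    · have hmul : ∀ i, L ∘ₗ LinearMap.mulLeft k (X i ^ d + g i) = 0 := by
        intro i
        refine b.ext fun m => ?_
        ext s
        have : s.1 ≠ m + Finsupp.single i d := by
          intro h
          have := s.2 i
          rw [h] at this
          simp at this
        rw [LinearMap.comp_apply, hL, LinearMap.mulLeft_apply, hb, ← perturbedMonomial_add_single hd,
          ← hb, b.repr_self]
        simp [this.symm]
      intro p hp
      rw [Submodule.restrictScalars_mem] at hp
      obtain ⟨c, hc⟩ := Ideal.mem_span_range_iff_exists_fun.1 hp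
      rw [LinearMap.mem_ker, ← hc, map_sum]
      refine Finset.sum_eq_zero fun i _ => ?_
      rw [mul_comm]
      exact LinearMap.congr_fun (hmul i) (c i)
  let e : (S →₀ k) ≃ₗ[k] (MvPolynomial σ k ⧸ I) :=
    (L.quotKerEquivOfSurjective hLsurj).symm.trans ((Submodule.quotEquivOfEq _ _ hker).trans
      (Submodule.Quotient.restrictScalarsEquiv k I))
  let eS : S ≃ (σ → Fin d) :=
    { toFun := fun m i => ⟨m.1 i, m.2 i⟩
      invFun := fun f => ⟨Finsupp.equivFunOnFinite.symm fun i => (f i : ℕ), fun i => (f i).2⟩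
      left_inv := fun m => by ext; rfl
      right_inv := fun f => by ext; rfl }
  let : Fintype S := Fintype.ofEquiv _ eS.symm
  rw [← e.finrank_eq, Module.finrank_finsupp_self, Fintype.card_congr eS]
  simp

end PerturbedMonomials

/-! ### Real zeros of systems of odd degree -/

section OddSystems

open MvPolynomial

/-- For odd `d` and `deg gᵢ ≤ d`, the system `xᵢ ^ d + t gᵢ(x) = 0` has a real solution for
arbitrarily large `t`. -/
theorem exists_real_zero_perturbed {σ : Type*} [Fintype σ] {d : ℕ} (hd : Odd d)
    (g : σ → MvPolynomial σ ℝ) (hg : ∀ i, (g i).totalDegree ≤ d) (r : ℝ) :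
    ∃ t > r, ∃ y : σ → ℝ, ∀ i, y i ^ d + t * eval y (g i) = 0 := by
  obtain ⟨E, hE, h⟩ := exists_countable_perturbedMonomial_basis d g hg
  obtain ⟨t, htE, htr⟩ := (hE.dense_compl ℝ).exists_mem_open isOpen_Ioi ⟨r + 1, lt_add_one r⟩
  obtain ⟨hli, hsp⟩ := h t htE
  have hfin := finrank_quotient_span_perturbed hd.pos _ hli hsp
  obtain ⟨φ⟩ := exists_algHom_real_of_odd_finrank (hfin ▸ hd.pow)
  let π := Ideal.Quotient.mkₐ ℝ
    (Ideal.span (Set.range fun i => (X i ^ d + C t * g i : MvPolynomial σ ℝ)))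
  refine ⟨t, htr, fun i => φ (π (X i)), fun i => ?_⟩
  have h1 : ∀ p, φ (π p) = eval (fun i => φ (π (X i))) p := by
    intro p
    have : φ.comp π = aeval fun i => φ (π (X i)) := by
      ext i
      simp
    rw [← aeval_eq_eval]
    exact DFunLike.congr_fun this p
  have h2 : π (X i ^ d + C t * g i) = 0 :=
    Ideal.Quotient.eq_zero_iff_mem.2 (Ideal.subset_span ⟨i, rfl⟩)
  have h3 := h1 (X i ^ d + C t * g i)
  rw [h2, map_zero] at h3
  simpa using h3.symm

theorem MvPolynomial.IsHomogeneous.eval_smul {σ : Type*} {R : Type*} [CommSemiring R]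
    {f : MvPolynomial σ R} {d : ℕ} (hf : f.IsHomogeneous d) (c : R) (x : σ → R) :
    eval (c • x) f = c ^ d * eval x f := by
  rw [eval_eq, eval_eq, Finset.mul_sum]
  refine Finset.sum_congr rfl fun m hm => ?_
  have h1 : ∑ i ∈ m.support, m i = d := by
    rw [hf.degree_eq_sum_deg_support hm]
  simp only [Pi.smul_apply, smul_eq_mul, mul_pow, Finset.prod_mul_distrib, Finset.prod_pow_eq_pow_sum, h1]
  ring

/-- A system of `n` real forms of the same odd degree in `n + 1` variables has approximate zeros on
the unit sphere. -/
theorem exists_norm_eq_one_abs_eval_le {n d : ℕ} (hd : Odd d)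
    (f : Fin n → MvPolynomial (Fin (n + 1)) ℝ) (hf : ∀ i, (f i).IsHomogeneous d)
    {ε : ℝ} (hε : 0 < ε) :
    ∃ z : EuclideanSpace ℝ (Fin (n + 1)), ‖z‖ = 1 ∧ ∀ i, |eval (z : Fin (n + 1) → ℝ) (f i)| ≤ ε := by
  let s : Fin (n + 1) → MvPolynomial (Fin n) ℝ := Fin.cons 1 X
  have hs : ∀ j, (s j).totalDegree ≤ 1 := by
    intro j
    refine Fin.cases ?_ (fun j => ?_) j <;> simp [s]
  have hg : ∀ i, (aeval s (f i)).totalDegree ≤ d := by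
    intro i
    rw [aeval_def, eval₂_eq]
    refine totalDegree_finsetSum_le fun m hm => ?_
    refine (totalDegree_mul _ _).trans ?_
    rw [algebraMap_eq, totalDegree_C, zero_add]
    refine (totalDegree_finsetProd _ _).trans ?_
    rw [(hf i).degree_eq_sum_deg_support hm]
    refine Finset.sum_le_sum fun j _ => ?_
    refine (totalDegree_pow _ _).trans ?_
    simpa using Nat.mul_le_mul_left (m j) (hs j)
  obtain ⟨t, ht, y, hy⟩ := exists_real_zero_perturbed hd (fun i => aeval s (f i)) hg ε⁻¹
  have ht0 : 0 < t := (inv_pos.2 hε).trans ht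
  let x : EuclideanSpace ℝ (Fin (n + 1)) := WithLp.toLp 2 (Fin.cons 1 y)
  have hx : x ≠ 0 := by
    intro h
    have := congrArg (fun v : EuclideanSpace ℝ (Fin (n + 1)) => v 0) h
    simp [x] at this
  have hev : ∀ i, eval y (aeval s (f i)) = eval (x : Fin (n + 1) → ℝ) (f i) := by
    intro i
    rw [← aeval_eq_eval, ← aeval_eq_eval]
    have : ((aeval y : MvPolynomial (Fin n) ℝ →ₐ[ℝ] ℝ).comp (aeval s)) = aeval (x : Fin (n + 1) → ℝ) := by
      ext j
      refine Fin.cases ?_ (fun j => ?_) j <;> simp [s, x]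
    exact DFunLike.congr_fun this (f i)
  have hz : ‖(‖x‖⁻¹ • x)‖ = 1 := norm_smul_inv_norm (𝕜 := ℝ) hx
  refine ⟨‖x‖⁻¹ • x, hz, fun i => ?_⟩
  have h1 : eval ((‖x‖⁻¹ • x : EuclideanSpace ℝ (Fin (n + 1))) : Fin (n + 1) → ℝ) (f i) =
      ‖x‖⁻¹ ^ d * eval (x : Fin (n + 1) → ℝ) (f i) := (hf i).eval_smul ‖x‖⁻¹ x
  have h2 := hy i
  rw [hev] at h2
  have h3 : |(‖x‖⁻¹ • x) i.succ| ≤ 1 := by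
    have := PiLp.norm_apply_le (‖x‖⁻¹ • x) i.succ
    rwa [hz] at this
  have h4 : (‖x‖⁻¹ • x) i.succ = ‖x‖⁻¹ * y i := by simp [x]
  -- Homogeneity carries the equation to the unit vector, whose coordinates are at most 1 in
  -- absolute value.
  have h5 : ((‖x‖⁻¹ • x) i.succ) ^ d +
      t * eval ((‖x‖⁻¹ • x : EuclideanSpace ℝ (Fin (n + 1))) : Fin (n + 1) → ℝ) (f i) = 0 := by
    rw [h1, h4, mul_pow]
    linear_combination ‖x‖⁻¹ ^ d * h2
  set w := eval ((‖x‖⁻¹ • x : EuclideanSpace ℝ (Fin (n + 1))) : Fin (n + 1) → ℝ) (f i)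
  have h6 : t * |w| ≤ 1 := by
    have : t * w = -((‖x‖⁻¹ • x) i.succ) ^ d := by linear_combination h5
    rw [← abs_of_pos ht0, ← abs_mul, this, abs_neg, abs_pow]
    exact pow_le_one₀ (abs_nonneg _) h3
  have h7 : 1 ≤ ε * t := by
    have := mul_le_mul_of_nonneg_left ht.le hε.le
    rwa [mul_inv_cancel₀ hε.ne'] at this
  nlinarith [abs_nonneg w]

end OddSystems

/-! ### The Borsuk–Ulam theorem -/

section BorsukUlam

open MvPolynomial

theorem eval_sum_X_sq {n : ℕ} {z : EuclideanSpace ℝ (Fin n)} (hz : ‖z‖ = 1) :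
    eval (z : Fin n → ℝ) (∑ j, X j ^ 2 : MvPolynomial (Fin n) ℝ) = 1 := by
  have := EuclideanSpace.real_norm_sq_eq z
  rw [hz] at this
  simpa using this.symm

/-- On the unit sphere, the odd part of a polynomial agrees with a form of any odd degree that is
at least the degree of the polynomial. -/
theorem exists_isHomogeneous_eval_eq_odd_part {n N : ℕ} (q : MvPolynomial (Fin n) ℝ)
    (hq : q.totalDegree ≤ 2 * N + 1) :
    ∃ f : MvPolynomial (Fin n) ℝ, f.IsHomogeneous (2 * N + 1) ∧
      ∀ z : EuclideanSpace ℝ (Fin n), ‖z‖ = 1 →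
        eval (z : Fin n → ℝ) f = (eval (z : Fin n → ℝ) q - eval (-z : Fin n → ℝ) q) / 2 := by
  -- The factor `∑ xⱼ²` equals 1 on the sphere, so its powers raise the odd components to a common
  -- degree.
  refine ⟨∑ k ∈ Finset.range (N + 1),
    homogeneousComponent (2 * k + 1) q * (∑ j, X j ^ 2) ^ (N - k), ?_, ?_⟩
  · refine IsHomogeneous.sum _ _ _ fun k hk => ?_
    have hk' : 2 * N + 1 = (2 * k + 1) + 2 * (N - k) := by
      have := Finset.mem_range.1 hk
      omega
    rw [hk']
    exact (homogeneousComponent_isHomogeneous _ _).mul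
      ((IsHomogeneous.sum _ _ _ fun j _ => isHomogeneous_X_pow j 2).pow _)
  · intro z hz
    have hsum : q = ∑ k ∈ Finset.range (N + 1),
        (homogeneousComponent (2 * k) q + homogeneousComponent (2 * k + 1) q) := by
      have h1 : ∑ i ∈ Finset.range (2 * (N + 1)), homogeneousComponent i q = q := by
        conv_rhs => rw [← sum_homogeneousComponent q]
        symm
        refine Finset.sum_subset (fun i hi => ?_) fun i _ hi => ?_
        · rw [Finset.mem_range] at hi ⊢
          omega
        · rw [Finset.mem_range] at hi
          exact homogeneousComponent_eq_zero _ _ (by omega)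
      conv_lhs => rw [← h1]
      generalize N + 1 = M
      induction M with
      | zero => simp
      | succ M ih =>
        rw [Finset.sum_range_succ, ← ih, mul_add, Finset.sum_range_succ, Finset.sum_range_succ,
          add_assoc]
    have hneg : ∀ i, eval (-z : Fin n → ℝ) (homogeneousComponent i q) =
        (-1) ^ i * eval (z : Fin n → ℝ) (homogeneousComponent i q) := by
      intro i
      rw [← (homogeneousComponent_isHomogeneous i q).eval_smul]
      congr 2
      simp
    have e1 : eval (z : Fin n → ℝ) q - eval (-z : Fin n → ℝ) q =
        ∑ k ∈ Finset.range (N + 1), 2 * eval (z : Fin n → ℝ) (homogeneousComponent (2 * k + 1) q) := by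
      conv_lhs => rw [hsum]
      rw [map_sum, map_sum, ← Finset.sum_sub_distrib]
      refine Finset.sum_congr rfl fun k _ => ?_
      rw [map_add, map_add, hneg, hneg, pow_succ, pow_mul]
      norm_num
      ring
    rw [e1, map_sum, ← Finset.mul_sum, mul_div_cancel_left₀ _ two_ne_zero]
    refine Finset.sum_congr rfl fun k _ => ?_
    rw [map_mul, map_pow, eval_sum_X_sq hz, one_pow, mul_one]

/-- Continuous functions on the sphere are uniform limits of polynomials. -/
theorem exists_mvPolynomial_near_on_sphere {n : ℕ} (h : C(UnitSphere n, ℝ)) {ε : ℝ} (hε : 0 < ε) :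
    ∃ q : MvPolynomial (Fin (n + 1)) ℝ,
      ∀ z : UnitSphere n, |eval (z.1 : Fin (n + 1) → ℝ) q - h z| < ε := by
  let x : Fin (n + 1) → C(UnitSphere n, ℝ) := fun j => ⟨fun z => z.1 j, by fun_prop⟩
  have hsep : (aeval (R := ℝ) x).range.SeparatesPoints := by
    intro z w hzw
    obtain ⟨j, hj⟩ : ∃ j, z.1 j ≠ w.1 j := by
      by_contra! hcon
      exact hzw (Subtype.ext (PiLp.ext hcon))
    exact ⟨x j, ⟨x j, ⟨X j, by simp⟩, rfl⟩, hj⟩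
  obtain ⟨⟨_, q, rfl⟩, hq⟩ :=
    ContinuousMap.exists_mem_subalgebra_near_continuousMap_of_separatesPoints _ hsep h ε hε
  refine ⟨q, fun z => ?_⟩
  have hz := (ContinuousMap.norm_coe_le_norm _ z).trans_lt hq
  have : (aeval x q) z = eval (z.1 : Fin (n + 1) → ℝ) q := by
    rw [← aeval_eq_eval]
    have : (ContinuousMap.evalAlgHom ℝ ℝ z).comp (aeval x) =
        aeval (z.1 : Fin (n + 1) → ℝ) := by
      ext j
      simp [x]
    exact DFunLike.congr_fun this q
  simpa [this] using hz

/-- The **Borsuk–Ulam theorem** for odd maps. -/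
theorem borsukUlam_odd {n : ℕ} (h : C(UnitSphere n, EuclideanSpace ℝ (Fin n)))
    (hodd : ∀ z, h (-z) = -h z) : ∃ z, h z = 0 := by
  by_contra! hne
  have : Nonempty (UnitSphere n) := (NormedSpace.sphere_nonempty.2 zero_le_one).to_subtype
  -- `WithLp.ofLp` passes to the sup norm, so coordinatewise bounds suffice: at `w`, approximation
  -- error and form value each cost `δ / 3`.
  obtain ⟨z₀, hz₀⟩ := (isCompact_univ (X := UnitSphere n)).exists_isMinOn Set.univ_nonempty
    (f := fun z => ‖WithLp.ofLp (h z)‖) (by fun_prop)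
  set δ := ‖WithLp.ofLp (h z₀)‖ with hδ
  have hδ0 : 0 < δ := by
    refine norm_pos_iff.2 fun h0 => hne z₀ ?_
    ext i
    exact congrFun h0 i
  have hmin : ∀ z, δ ≤ ‖WithLp.ofLp (h z)‖ := fun z => hz₀.2 (Set.mem_univ z)
  choose q hq using fun i : Fin n => exists_mvPolynomial_near_on_sphere
    (⟨fun z => h z i, by fun_prop⟩ : C(UnitSphere n, ℝ)) (show 0 < δ / 3 by positivity)
  simp only [ContinuousMap.coe_mk] at hq
  set N := Finset.univ.sup fun i => (q i).totalDegree
  have hN : ∀ i, (q i).totalDegree ≤ 2 * N + 1 := by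
    intro i
    have : (q i).totalDegree ≤ N := Finset.le_sup (f := fun i => (q i).totalDegree) (Finset.mem_univ i)
    omega
  choose f hf hfe using fun i => exists_isHomogeneous_eval_eq_odd_part (q i) (hN i)
  obtain ⟨z, hz, hzf⟩ := exists_norm_eq_one_abs_eval_le (odd_two_mul_add_one N) f hf
    (show 0 < δ / 3 by positivity)
  let w : UnitSphere n := ⟨z, by simpa using hz⟩
  refine (hmin w).not_gt ((pi_norm_lt_iff hδ0).2 fun i => ?_)
  have h1 := abs_lt.1 (hq i w)
  have h2 := abs_lt.1 (hq i (-w))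
  have h3 := abs_le.1 (hzf i)
  rw [hfe i z hz] at h3
  have h4 : h (-w) i = -h w i := by rw [hodd]; rfl
  have h5 : eval ((-w).1 : Fin (n + 1) → ℝ) (q i) = eval (-z : Fin (n + 1) → ℝ) (q i) := rfl
  have h6 : eval (w.1 : Fin (n + 1) → ℝ) (q i) = eval (z : Fin (n + 1) → ℝ) (q i) := rfl
  rw [h4, h5] at h2
  rw [h6] at h1
  rw [Real.norm_eq_abs, abs_lt]
  constructor <;> linarith [h1.1, h1.2, h2.1, h2.2, h3.1, h3.2]

/-- The **Borsuk–Ulam theorem**. -/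
theorem borsukUlam {n : ℕ} (h : C(UnitSphere n, EuclideanSpace ℝ (Fin n))) :
    ∃ z, h (-z) = h z := by
  obtain ⟨z, hz⟩ := borsukUlam_odd
    (⟨fun z => h z - h (-z), by fun_prop⟩ : C(UnitSphere n, EuclideanSpace ℝ (Fin n)))
    (fun z => by simp)
  exact ⟨z, (sub_eq_zero.1 hz).symm⟩

end BorsukUlam

theorem mainTheorem4 {X : Type*} [NormedAddCommGroup X] [NormedSpace ℝ X] [CompleteSpace X]
    (n : ℕ) (K : Set X) (hK : IsCompact K) :
    sphereEmbeddingWidth n K ≤ manifoldWidth n K := by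
  refine iSup₂_le fun c hc => le_iInf₂ fun a M => ?_
  obtain ⟨z, hz⟩ := borsukUlam (a.comp c)
  simp only [ContinuousMap.comp_apply] at hz
  set S := ⨆ f : K, ‖(f : X) - M (a f)‖ₑ
  have h1 : ‖(c z : X) - M (a (c z))‖ₑ ≤ S := le_iSup (fun f : K => ‖(f : X) - M (a f)‖ₑ) (c z)
  have h2 : ‖(c (-z) : X) - M (a (c (-z)))‖ₑ ≤ S :=
    le_iSup (fun f : K => ‖(f : X) - M (a f)‖ₑ) (c (-z))
  rw [hz, hc] at h2
  refine (iInf_le _ z).trans ?_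
  -- The common decoded point cancels in the difference of the two errors.
  have h3 : (2 : ℝ≥0∞) * ‖(c z : X)‖ₑ ≤ 2 * S := by
    calc (2 : ℝ≥0∞) * ‖(c z : X)‖ₑ = ‖(2 : ℝ) • (c z : X)‖ₑ := by
          rw [enorm_smul]
          congr 1
          simp [Real.enorm_eq_ofReal]
      _ = ‖((c z : X) - M (a (c z))) - (-(c z : X) - M (a (c z)))‖ₑ := by
          congr 1
          rw [two_smul]
          abel
      _ ≤ _ := enorm_sub_le
      _ ≤ S + S := add_le_add h1 h2
      _ = 2 * S := (two_mul S).symm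
  exact (ENNReal.mul_le_mul_iff_right two_ne_zero ENNReal.ofNat_ne_top).1 h3
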